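/- **Theorem (Convergence of LocHB).** Let $G=(V,E)$ be a finite simple undirected graph without isolated nodes, $A$ its adjacency matrix, $D$ its degree matrix, $d_v$ the degree of $v$, $\operatorname{vol}(S)=\sum_{v\in S}d_v$. Let $s\in V$, $\alpha\in(0,1)$, $\varepsilon>0$, and put $$W=D^{-1/2}AD^{-1/2},\quad Q=I-\tfrac{1-\alpha}{1+\alpha}W,\quad b=\tfrac{2\alpha}{1+\alpha}D^{-1/2}e_s,\quad \tilde\alpha=\tfrac{1-\sqrt\alpha}{1+\sqrt\alpha}.$$ For a vector $v$ and $S\subseteq V$ let $v_S$ be $v$ with the entries outside $S$ replaced by $0$. The local heavy-ball method (LocHB) with residual tolerance $\varepsilon$ is the sequence with $x^{(0)}=0$, $r^{(0)}=b$, $x^{(1)}=\Gamma r^{(0)}$ where $\Gamma=Q^{-1}(I-\tilde\alpha W)$, $r^{(1)}=b-Qx^{(1)}$ (so that $r^{(1)}=\tilde\alpha Wr^{(0)}$), and, for $t\ge1$, $$\hat x^{(t)}=(1+\tilde\alpha^2)\,r^{(t)}_{S_t}+\tilde\alpha^2\,(x^{(t)}-x^{(t-1)})_{S_t},\quad x^{(t+1)}=x^{(t)}+\hat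 x^{(t)},\quad r^{(t+1)}=r^{(t)}-\hat x^{(t)}+\tfrac{1-\alpha}{1+\alpha}W\hat x^{(t)},$$ where $S_t=\{u\in V:\ |r^{(t)}_u|\ge\varepsilon\sqrt{d_u}\}$ is the active set for all $t\ge0$. (For the accuracy $\|D^{-1/2}(x-Q^{-1}b)\|_\infty\le\varepsilon'$ one takes $\varepsilon=2\alpha\varepsilon'/(1+\alpha)$.) For $T\ge 1$ the runtime of the first $T$ iterations is $\mathcal T_T=\sum_{t<T}\operatorname{vol}(S_t)$, and $\overline{\operatorname{vol}}(S_T)=\frac1T\sum_{t<T}\operatorname{vol}(S_t)$. Let $W=U\Lambda U^\top$ with $U$ orthogonal and $\Lambda=\operatorname{diag}(\lambda_i)$. For $j<t$ let $H_{j,t}$ be the diagonal matrix with entries $\frac{\sin((t-j)\theta_i)}{\sin\theta_i}$, $\theta_i=\arccos\lambda_i$ (read as $t-j$ if $\lambda_i=1$ and as $(-1)^{t-j-1}(t-j)$ if $\lambda_i=-1$). For $i\le j$ let $S_{i,j}=S_i\cap\dots\cap S_{j-1}\cap(V\setminus S_j)$ (so $S_{j,j}=V\setminus S_j$). Define $$u_{0,t}=\frac1t\sum_{j=1}^{t-1}\tilde\alpha^{\,j-1}H_{j,t}U^\top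 Q\,(\Gamma r^{(0)})_{S_{1,j}},\qquad u_{k,t}=\frac1{t-k}\sum_{j=k}^{t-1}\tilde\alpha^{\,j-k}H_{j,t}\Big(\tfrac{1+\alpha}{1-\alpha}I-\Lambda\Big)U^\top r^{(k)}_{S_{k,j}}\quad(1\le k<t),$$ and $\beta_{k,t}=\|u_{k,t}\|_2/\|r^{(k)}\|_2$ (read as $0$ if $r^{(k)}=0$). Fix a horizon $N\in\mathbb N\cup\{\infty\}$ and let $\beta_k=\sup\{\beta_{k,t}:\ k<t\le N\}$ ($0$ if there is no such $t$). Let $y_0=y_1=\|r^{(0)}\|_2$ and $$y_{t+1}-2y_t+\frac{y_{t-1}}{(1+\beta_{t-1})(1+\beta_t)}=0\qquad(t\ge1).$$ Then all $\beta_k$ are finite, all $y_t$ are positive, and for all $1\le t\le N$ $$\|r^{(t)}\|_2\le\tilde\alpha^{\,t}\prod_{j=0}^{t-1}(1+\beta_j)\;y_t.$$ Moreover, let $1\le T\le N$ be such that the method has not stopped before $T$, i.e. $S_t\ne\emptyset$ for all $t<T$ (for instance, $T$ is the total number of iterations: $S_T=\emptyset$). Suppose that for some $c\in[0,2)$ the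 geometric means satisfy $\overline\beta_t:=\big(\prod_{j=0}^{t-1}(1+\beta_j)\big)^{1/t}\le1+\frac{c\sqrt\alpha}{1-\sqrt\alpha}$ for $1\le t\le T$. Then $$T\le\Big\lfloor\frac{1+\sqrt\alpha}{(2-c)\sqrt\alpha}\ln\frac{y_T}{\varepsilon}\Big\rfloor+1,\qquad \mathcal T_T\le\overline{\operatorname{vol}}(S_T)\Big(\Big\lfloor\frac{1+\sqrt\alpha}{(2-c)\sqrt\alpha}\ln\frac{y_T}{\varepsilon}\Big\rfloor+1\Big),$$ and consequently, if $\ln(y_T/\varepsilon)\ge1$, $$\mathcal T_T\le 2\cdot\frac{(1+\sqrt\alpha)\,\overline{\operatorname{vol}}(S_T)}{(2-c)\sqrt\alpha}\,\ln\frac{y_T}{\varepsilon}.$$ -/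

import Mathlib

open scoped Matrix

noncomputable section

namespace LocHB

/-- The Euclidean norm of a real vector indexed by the nodes. -/
def l2 {V : Type*} [Fintype V] (v : V → ℝ) : ℝ :=
  ‖(WithLp.toLp 2 v : EuclideanSpace ℝ V)‖

/-- The restriction `v_S`: the entries outside `S` are replaced by zero. -/
def restrict {V : Type*} (S : Set V) (v : V → ℝ) : V → ℝ :=
  S.indicator v

/-- The momentum parameter `α̃ = (1 - √α) / (1 + √α)`. -/
def momentum (α : ℝ) : ℝ :=
  (1 - √α) / (1 + √α)

section Method

variable {V : Type*} [Fintype V] [DecidableEq V] (G : SimpleGraph V) [DecidableRel G.Adj]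

/-- The matrix `D^{-1/2}`. -/
def invSqrtDeg : Matrix V V ℝ :=
  Matrix.diagonal fun v => 1 / √(G.degree v : ℝ)

/-- The normalized adjacency matrix `W = D^{-1/2} A D^{-1/2}`. -/
def normAdj : Matrix V V ℝ :=
  invSqrtDeg G * G.adjMatrix ℝ * invSqrtDeg G

/-- The system matrix `Q = I - (1-α)/(1+α) W`. -/
def sysMatrix (α : ℝ) : Matrix V V ℝ :=
  1 - ((1 - α) / (1 + α)) • normAdj G

/-- The right-hand side `b = 2α/(1+α) D^{-1/2} e_s`. -/
def rhs (α : ℝ) (s : V) : V → ℝ :=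
  (2 * α / (1 + α)) • (invSqrtDeg G *ᵥ Pi.single s 1)

/-- The volume of a set of nodes. -/
def vol (S : Finset V) : ℝ :=
  ∑ v ∈ S, (G.degree v : ℝ)

/-- The active nodes of a residual vector `r`, for the residual tolerance `ε`. -/
def activeNodes (ε : ℝ) (r : V → ℝ) : Finset V :=
  Finset.univ.filter fun u => ε * √(G.degree u : ℝ) ≤ |r u|

/-- The step matrix `Γ = Q⁻¹ (I - α̃ W)` of the first iterate `x⁽¹⁾ = Γ r⁽⁰⁾`; it is the one for
which `r⁽¹⁾ = α̃ W r⁽⁰⁾`. -/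
def initStep (α : ℝ) : Matrix V V ℝ :=
  (sysMatrix G α)⁻¹ * (1 - momentum α • normAdj G)

/-- What the method holds at time `t`: the iterates `x⁽ᵗ⁻¹⁾`, `x⁽ᵗ⁾` and the residual `r⁽ᵗ⁾`. -/
structure State (V : Type*) where
  xPrev : V → ℝ
  x : V → ℝ
  r : V → ℝ

/-- The local increment `x̂ = (1 + α̃²) r_S + α̃² (x⁽ᵗ⁾ - x⁽ᵗ⁻¹⁾)_S`, where `S` is the set of active
nodes. -/
def increment (α ε : ℝ) (σ : State V) : V → ℝ :=
  (1 + momentum α ^ 2) • restrict (activeNodes G ε σ.r : Set V) σ.r +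
    momentum α ^ 2 • restrict (activeNodes G ε σ.r : Set V) (σ.x - σ.xPrev)

/-- One step of the local heavy-ball method. -/
def step (α ε : ℝ) (σ : State V) : State V where
  xPrev := σ.x
  x := σ.x + increment G α ε σ
  r := σ.r - increment G α ε σ + ((1 - α) / (1 + α)) • (normAdj G *ᵥ increment G α ε σ)

/-- The local heavy-ball method. -/
def run (α ε : ℝ) (s : V) : ℕ → State V
  | 0 => { xPrev := 0, x := 0, r := rhs G α s }
  | 1 =>
    { xPrev := 0
      x := initStep G α *ᵥ rhs G α s
      r := rhs G α s - sysMatrix G α *ᵥ (initStep G α *ᵥ rhs G α s) }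
  | t + 2 => step G α ε (run α ε s (t + 1))

/-- The iterate `x⁽ᵗ⁾`. -/
def iterate (α ε : ℝ) (s : V) (t : ℕ) : V → ℝ :=
  (run G α ε s t).x

/-- The residual `r⁽ᵗ⁾`. -/
def residual (α ε : ℝ) (s : V) (t : ℕ) : V → ℝ :=
  (run G α ε s t).r

/-- The active set `S_t`. -/
def activeSet (α ε : ℝ) (s : V) (t : ℕ) : Finset V :=
  activeNodes G ε (residual G α ε s t)

/-- The runtime `∑_{t < T} vol(S_t)`. -/
def runtime (α ε : ℝ) (s : V) (T : ℕ) : ℝ :=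
  ∑ t ∈ Finset.range T, vol G (activeSet G α ε s t)

/-- The average volume `(1/T) ∑_{t < T} vol(S_t)` of the active sets. -/
def avgVol (α ε : ℝ) (s : V) (T : ℕ) : ℝ :=
  1 / (T : ℝ) * ∑ t ∈ Finset.range T, vol G (activeSet G α ε s t)

/-- `S_{i,j} = S_i ∩ ⋯ ∩ S_{j-1} ∩ (V \ S_j)`; the intersection is everything if `i = j`. -/
def exitSet (α ε : ℝ) (s : V) (i j : ℕ) : Set V :=
  {v | (∀ l, i ≤ l → l < j → v ∈ activeSet G α ε s l) ∧ v ∉ activeSet G α ε s j}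

/-- The diagonal entry of `H_{j,t}` at an eigenvalue `l = cos θ`, where `m = t - j ≥ 1`:
`sin (mθ) / sin θ`, with its limit values `m` at `l = 1` and `(-1)^(m-1) m` at `l = -1`. -/
def hEntry (l : ℝ) (m : ℕ) : ℝ :=
  if l = 1 then m
  else if l = -1 then (-1) ^ (m - 1) * m
  else Real.sin (m * Real.arccos l) / Real.sin (Real.arccos l)

/-- The diagonal matrix `H_{j,t}`, for the eigenvalues `lam` of `W`. -/
def hMatrix (lam : V → ℝ) (j t : ℕ) : Matrix V V ℝ :=
  Matrix.diagonal fun i => hEntry (lam i) (t - j)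

/-- The vectors `u_{k,t}`, in the basis of the eigendecomposition `W = U diag(lam) Uᵀ`. -/
def uVec (α ε : ℝ) (s : V) (U : Matrix V V ℝ) (lam : V → ℝ) (k t : ℕ) : V → ℝ :=
  if k = 0 then
    (1 / (t : ℝ)) • ∑ j ∈ Finset.Ico 1 t, momentum α ^ (j - 1) •
      ((hMatrix lam j t * Uᵀ * sysMatrix G α) *ᵥ
        restrict (exitSet G α ε s 1 j) (iterate G α ε s 1))
  else
    (1 / ((t : ℝ) - (k : ℝ))) • ∑ j ∈ Finset.Ico k t, momentum α ^ (j - k) •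
      ((hMatrix lam j t * (((1 + α) / (1 - α)) • 1 - Matrix.diagonal lam) * Uᵀ) *ᵥ
        restrict (exitSet G α ε s k j) (residual G α ε s k))

/-- The running residual reduction rate `β_{k,t} = ‖u_{k,t}‖₂ / ‖r⁽ᵏ⁾‖₂`. -/
def runningRate (α ε : ℝ) (s : V) (U : Matrix V V ℝ) (lam : V → ℝ) (k t : ℕ) : ℝ :=
  l2 (uVec G α ε s U lam k t) / l2 (residual G α ε s k)

/-- The rates `β_{k,t}` with `k < t` that are compared up to the horizon `N`, which may be `∞`. -/
def rates (α ε : ℝ) (s : V) (U : Matrix V V ℝ) (lam : V → ℝ) (N : ℕ∞) (k : ℕ) : Set ℝ :=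
  {q | ∃ t : ℕ, k < t ∧ (t : ℕ∞) ≤ N ∧ q = runningRate G α ε s U lam k t}

/-- The residual reduction rate `β_k = max_t β_{k,t}`. -/
def rate (α ε : ℝ) (s : V) (U : Matrix V V ℝ) (lam : V → ℝ) (N : ℕ∞) (k : ℕ) : ℝ :=
  sSup (rates G α ε s U lam N k)

end Method

/-- The running geometric mean `(∏_{j < t} (1 + β_j))^{1/t}`. -/
def geomMean (β : ℕ → ℝ) (t : ℕ) : ℝ :=
  (∏ j ∈ Finset.range t, (1 + β j)) ^ (1 / (t : ℝ))

end LocHB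

end

/-! The local step is the full heavy-ball step minus a `slack` supported on the inactive nodes.
Hence the residual obeys r(t+2) = 2α̃ W r(t+1) - α̃² r(t) + Q slack(t+1) (`residual_add_two`).
Dividing r(t) by α̃^t and passing to the eigenbasis of W turns this into a forced Chebyshev
recurrence in each eigenvalue: the homogeneous part is cos(tθ), of modulus at most 1, and the
forcing enters through the entries of H (`eq_of_chebyshev_recurrence`).

At a fixed node the momentum is erased whenever the node is inactive, so the slack unrolls into past
residuals restricted to the exit sets (`slack_eq`). Exchanging the two sums groups the forcing into
the vectors u_{k,t} (`scaled_residual_apply`). Taking norms, n_t = ‖r(t)‖/α̃^t satisfies n_t ≤ n_0 +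
tβ_0 n_0 + ∑ 2(t-k)β_k n_k. The sequence ∏(1+β_j) y_t satisfies this with equality (`majorant_eq`),
hence dominates n_t (`le_majorant`).

For the runtime, an active node forces ‖r(T-1)‖ ≥ ε, while the geometric mean hypothesis makes the
bound decay like exp(-t(2-c)√α/(1+√α)); comparing the two bounds T. -/

namespace LocHB

/-! ### The Euclidean norm and orthogonal invariance -/

section Norm

variable {V : Type*} [Fintype V]

theorem l2_sq (v : V → ℝ) : l2 v ^ 2 = ∑ i, v i ^ 2 := by
  simp [l2, EuclideanSpace.norm_sq_eq]

theorem l2_nonneg (v : V → ℝ) : 0 ≤ l2 v := norm_nonneg _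

theorem l2_zero : l2 (0 : V → ℝ) = 0 := by simp [l2]

theorem l2_add_le (v w : V → ℝ) : l2 (v + w) ≤ l2 v + l2 w := by
  simpa [l2] using norm_add_le (WithLp.toLp 2 v : EuclideanSpace ℝ V) (WithLp.toLp 2 w)

theorem l2_smul (c : ℝ) (v : V → ℝ) : l2 (c • v) = |c| * l2 v := by
  simpa [l2] using norm_smul c (WithLp.toLp 2 v : EuclideanSpace ℝ V)

theorem l2_sum_le {ι : Type*} (s : Finset ι) (f : ι → V → ℝ) :
    l2 (∑ j ∈ s, f j) ≤ ∑ j ∈ s, l2 (f j) := by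
  classical
  induction s using Finset.induction_on with
  | empty => simp [l2_zero]
  | insert a s ha ih =>
    rw [Finset.sum_insert ha, Finset.sum_insert ha]
    exact (l2_add_le _ _).trans (by linarith)

theorem l2_mono {v w : V → ℝ} (h : ∀ i, |v i| ≤ |w i|) : l2 v ≤ l2 w := by
  refine (sq_le_sq₀ (l2_nonneg v) (l2_nonneg w)).1 ?_
  rw [l2_sq, l2_sq]
  exact Finset.sum_le_sum fun i _ => sq_le_sq.2 (h i)

theorem abs_apply_le_l2 (v : V → ℝ) (i : V) : |v i| ≤ l2 v := by
  simpa [l2] using PiLp.norm_apply_le (WithLp.toLp 2 v : EuclideanSpace ℝ V) i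

theorem eq_zero_of_l2_eq_zero {v : V → ℝ} (h : l2 v = 0) : v = 0 := by
  ext i
  simpa [h] using abs_apply_le_l2 v i

theorem l2_transpose_mulVec [DecidableEq V] {U : Matrix V V ℝ}
    (hU : U ∈ Matrix.orthogonalGroup V ℝ) (v : V → ℝ) : l2 (Uᵀ *ᵥ v) = l2 v := by
  have h : l2 (Uᵀ *ᵥ v) ^ 2 = l2 v ^ 2 := by
    have hd : ∀ w : V → ℝ, l2 w ^ 2 = w ⬝ᵥ w := fun w => by
      rw [l2_sq]; simp [dotProduct, sq]
    have hUU : U * Uᵀ = 1 := (Matrix.mem_orthogonalGroup_iff V ℝ).1 hU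
    rw [hd, hd, Matrix.dotProduct_mulVec, Matrix.vecMul_transpose, Matrix.mulVec_mulVec, hUU,
      Matrix.one_mulVec]
  exact (sq_eq_sq₀ (l2_nonneg _) (l2_nonneg _)).1 h

end Norm

/-! ### Chebyshev polynomials of the second kind and the forced recurrence -/

section Chebyshev

theorem hEntry_zero (l : ℝ) : hEntry l 0 = 0 := by simp [hEntry]

theorem sin_arccos_pos {l : ℝ} (hl : l ∈ Set.Icc (-1 : ℝ) 1) (h₁ : l ≠ 1) (h₂ : l ≠ -1) :
    0 < Real.sin (Real.arccos l) := by
  refine Real.sin_pos_of_pos_of_lt_pi (Real.arccos_pos.2 (lt_of_le_of_ne hl.2 h₁)) ?_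
  refine lt_of_le_of_ne (Real.arccos_le_pi l) fun h => ?_
  exact h₂ (le_antisymm (Real.arccos_eq_pi.1 h) hl.1)

theorem hEntry_one {l : ℝ} (hl : l ∈ Set.Icc (-1 : ℝ) 1) : hEntry l 1 = 1 := by
  unfold hEntry
  split_ifs with h₁ h₂
  · simp
  · simp
  · simp [(sin_arccos_pos hl h₁ h₂).ne']

theorem hEntry_add_two {l : ℝ} (hl : l ∈ Set.Icc (-1 : ℝ) 1) (m : ℕ) :
    hEntry l (m + 2) = 2 * l * hEntry l (m + 1) - hEntry l m := by
  unfold hEntry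
  split_ifs with h₁ h₂
  · subst h₁; push_cast; ring
  · subst h₂
    -- At `m = 0` the exponent `m - 1` truncates, so this value is checked apart.
    cases m with
    | zero => norm_num
    | succ m => simp only [Nat.add_sub_cancel, show m + 1 + 2 - 1 = m + 2 by omega]; push_cast; ring
  · have hs := (sin_arccos_pos hl h₁ h₂).ne'
    have e₁ : ((m + 2 : ℕ) : ℝ) * Real.arccos l
        = ((m + 1 : ℕ) : ℝ) * Real.arccos l + Real.arccos l := by push_cast; ring
    have e₂ : (m : ℝ) * Real.arccos l
        = ((m + 1 : ℕ) : ℝ) * Real.arccos l - Real.arccos l := by push_cast; ring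
    rw [e₁, e₂, Real.sin_add, Real.sin_sub, Real.cos_arccos hl.1 hl.2]
    field_simp
    ring

theorem abs_sin_nat_mul_le (m : ℕ) (θ : ℝ) : |Real.sin (m * θ)| ≤ m * |Real.sin θ| := by
  induction m with
  | zero => simp
  | succ m ih =>
    have h₁ := mul_le_of_le_one_right (abs_nonneg (Real.sin (m * θ))) (Real.abs_cos_le_one θ)
    have h₂ := mul_le_of_le_one_left (abs_nonneg (Real.sin θ)) (Real.abs_cos_le_one (m * θ))
    have h₃ := abs_add_le (Real.sin (m * θ) * Real.cos θ) (Real.cos (m * θ) * Real.sin θ)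
    rw [abs_mul, abs_mul] at h₃
    rw [show ((m + 1 : ℕ) : ℝ) * θ = m * θ + θ by push_cast; ring, Real.sin_add]
    push_cast
    linarith

theorem abs_hEntry_le {l : ℝ} (hl : l ∈ Set.Icc (-1 : ℝ) 1) (m : ℕ) : |hEntry l m| ≤ m := by
  unfold hEntry
  split_ifs with h₁ h₂
  · simp
  · simp [abs_mul]
  · have hs := sin_arccos_pos hl h₁ h₂
    rw [abs_div, div_le_iff₀ (abs_pos.2 hs.ne')]
    exact abs_sin_nat_mul_le m _

/-- Solution of the inhomogeneous Chebyshev recurrence. -/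
theorem eq_of_chebyshev_recurrence {l : ℝ} (hl : l ∈ Set.Icc (-1 : ℝ) 1) {a g : ℕ → ℝ}
    (h₁ : a 1 = l * a 0) (h : ∀ t, a (t + 2) = 2 * l * a (t + 1) - a t + g (t + 1)) (t : ℕ) :
    a t = Real.cos (t * Real.arccos l) * a 0 + ∑ j ∈ Finset.Ico 1 t, hEntry l (t - j) * g j := by
  induction t using Nat.twoStepInduction with
  | zero => simp
  | one => simp [h₁, Real.cos_arccos hl.1 hl.2]
  | more t ih₀ ih₁ =>
    -- The added term `j = t` carries `hEntry l 0 = 0`; both previous sums thus share one range.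
    have hS : ∑ j ∈ Finset.Ico 1 (t + 1), hEntry l (t - j) * g j
        = ∑ j ∈ Finset.Ico 1 t, hEntry l (t - j) * g j := by
      refine (Finset.sum_subset (Finset.Ico_subset_Ico_right (Nat.le_succ t)) ?_).symm
      intro j hj hj'
      rw [Finset.mem_Ico] at hj hj'
      rw [show t - j = 0 by omega, hEntry_zero, zero_mul]
    have hR : ∑ j ∈ Finset.Ico 1 (t + 1), hEntry l (t + 2 - j) * g j
        = 2 * l * (∑ j ∈ Finset.Ico 1 (t + 1), hEntry l (t + 1 - j) * g j)
          - ∑ j ∈ Finset.Ico 1 t, hEntry l (t - j) * g j := by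
      rw [← hS, Finset.mul_sum, ← Finset.sum_sub_distrib]
      refine Finset.sum_congr rfl fun j hj => ?_
      rw [Finset.mem_Ico] at hj
      rw [show t + 2 - j = (t - j) + 2 by omega, show t + 1 - j = (t - j) + 1 by omega,
        hEntry_add_two hl]
      ring
    have hC : Real.cos ((t + 2 : ℕ) * Real.arccos l)
        = 2 * l * Real.cos ((t + 1 : ℕ) * Real.arccos l) - Real.cos (t * Real.arccos l) := by
      have e₁ : ((t + 2 : ℕ) : ℝ) * Real.arccos l
          = ((t + 1 : ℕ) : ℝ) * Real.arccos l + Real.arccos l := by push_cast; ring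
      have e₂ : (t : ℝ) * Real.arccos l
          = ((t + 1 : ℕ) : ℝ) * Real.arccos l - Real.arccos l := by push_cast; ring
      rw [e₁, e₂, Real.cos_add, Real.cos_sub, Real.cos_arccos hl.1 hl.2]
      ring
    rw [Finset.sum_Ico_succ_top (by omega), show t + 2 - (t + 1) = 1 by omega, hEntry_one hl, hR, hC,
      h, ih₁]
    linear_combination -ih₀

end Chebyshev

/-! ### The momentum parameter and recursions with resets -/

section Scalar

theorem one_sub_momentum_pos {α : ℝ} (hα : 0 < α) : 0 < 1 - momentum α := by
  have := Real.sqrt_pos.2 hα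
  rw [momentum, sub_pos, div_lt_one (by linarith)]
  linarith

theorem momentum_pos {α : ℝ} (h₁ : α < 1) : 0 < momentum α := by
  have := Real.sqrt_nonneg α
  have : √α < 1 := by
    rw [Real.sqrt_lt' one_pos]; simpa using h₁
  exact div_pos (by linarith) (by linarith)

/-- Since 1 + α̃² = 2(1+α)/(1+√α)², the factor 1+α cancels. This identity gives W the coefficient
2α̃ that the Chebyshev recurrence requires. -/
theorem one_add_momentum_sq_mul {α : ℝ} (hα : 0 < α) :
    (1 + momentum α ^ 2) * ((1 - α) / (1 + α)) = 2 * momentum α := by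
  have h := Real.sqrt_pos.2 hα
  have h₂ := Real.sq_sqrt hα.le
  have h₃ : 1 + √α ≠ 0 := by positivity
  rw [momentum]
  generalize √α = q at *
  subst h₂
  have : 1 + q ^ 2 ≠ 0 := by positivity
  field_simp
  ring

open Classical in
/-- Unrolling of a recursion that is reset to zero whenever `p` fails. -/
theorem unroll_reset (p : ℕ → Prop) (A B : ℝ) (r d : ℕ → ℝ)
    (h : ∀ t, 1 ≤ t → d (t + 1) = if p t then A * r t + B * d t else 0) (t : ℕ) (ht : 1 ≤ t) :
    A * r t + B * d t = ∑ k ∈ Finset.Ico 1 (t + 1),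
        A * B ^ (t - k) * (if ∀ i, k ≤ i → i < t → p i then r k else 0)
      + B ^ t * (if ∀ i, 1 ≤ i → i < t → p i then d 1 else 0) := by
  induction t, ht using Nat.le_induction with
  | base =>
    have : ∀ i, 1 ≤ i → i < 1 → p i := fun i _ _ => by omega
    simp only [Nat.reduceAdd, Finset.sum_Ico_succ_top le_rfl, Finset.Ico_self, Finset.sum_empty,
      if_pos this]
    ring
  | succ t ht ih =>
    have hiff : ∀ k, k ≤ t →
        ((∀ i, k ≤ i → i < t + 1 → p i) ↔ p t ∧ ∀ i, k ≤ i → i < t → p i) := by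
      intro k hk
      refine ⟨fun H => ⟨H t hk (by omega), fun i h₁ h₂ => H i h₁ (by omega)⟩, ?_⟩
      rintro ⟨H₁, H₂⟩ i h₁ h₂
      rcases Nat.lt_succ_iff_lt_or_eq.1 h₂ with h₃ | rfl
      · exact H₂ i h₁ h₃
      · exact H₁
    rw [h t ht, Finset.sum_Ico_succ_top (by omega)]
    have htop : ∀ i, t + 1 ≤ i → i < t + 1 → p i := fun i _ _ => by omega
    rw [if_pos htop]
    simp only [hiff 1 ht]
    have hsum : ∑ k ∈ Finset.Ico 1 (t + 1), A * B ^ (t + 1 - k) *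
          (if ∀ i, k ≤ i → i < t + 1 → p i then r k else 0)
        = if p t then B * ∑ k ∈ Finset.Ico 1 (t + 1),
          A * B ^ (t - k) * (if ∀ i, k ≤ i → i < t → p i then r k else 0) else 0 := by
      split_ifs with hp
      · rw [Finset.mul_sum]
        refine Finset.sum_congr rfl fun k hk => ?_
        rw [Finset.mem_Ico] at hk
        simp only [hiff k (by omega), hp, true_and]
        rw [show t + 1 - k = (t - k) + 1 by omega]
        ring
      · refine Finset.sum_eq_zero fun k hk => ?_
        rw [Finset.mem_Ico] at hk
        rw [if_neg fun H => hp ((hiff k (by omega)).1 H).1, mul_zero]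
    rw [hsum]
    by_cases hp : p t
    · simp only [hp, if_true, true_and, ih]
      rw [Nat.sub_self]
      ring_nf
    · simp [hp]

end Scalar

/-! ### The comparison sequence y -/

section Majorant

variable {β y : ℕ → ℝ}

/-- The divisor is at least 1, so while y is positive it is convex, and its first increment is zero.
Positivity and monotonicity need each other in the induction. -/
theorem majorant_pos_mono (hβ : ∀ k, 0 ≤ β k) (h₀ : 0 < y 0) (h₁ : y 1 = y 0)
    (hy : ∀ t, 1 ≤ t → y (t + 1) - 2 * y t + y (t - 1) / ((1 + β (t - 1)) * (1 + β t)) = 0)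
    (t : ℕ) : 0 < y t ∧ y t ≤ y (t + 1) := by
  induction t with
  | zero => exact ⟨h₀, h₁.ge⟩
  | succ t ih =>
    have hp : 0 < y (t + 1) := ih.1.trans_le ih.2
    refine ⟨hp, ?_⟩
    have h := hy (t + 1) (by omega)
    rw [Nat.add_sub_cancel] at h
    have hd : y t / ((1 + β t) * (1 + β (t + 1))) ≤ y t := by
      refine div_le_self ih.1.le ?_
      nlinarith [hβ t, hβ (t + 1), mul_nonneg (hβ t) (hβ (t + 1))]
    linarith [ih.2]

/-- P_t = ∏(1+β_j) y_t has second difference 2β_t P_t, and summing twice gives the weights 2(t-k).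
The weight of β_0 is only t because P_1 - P_0 = β_0 P_0. -/
theorem majorant_eq (hβ : ∀ k, 0 ≤ β k) (h₁ : y 1 = y 0)
    (hy : ∀ t, 1 ≤ t → y (t + 1) - 2 * y t + y (t - 1) / ((1 + β (t - 1)) * (1 + β t)) = 0)
    (t : ℕ) :
    (∏ j ∈ Finset.range t, (1 + β j)) * y t = y 0 + t * (β 0 * y 0)
      + ∑ k ∈ Finset.Ico 1 t,
        2 * ((t : ℝ) - k) * (β k * ((∏ j ∈ Finset.range k, (1 + β j)) * y k)) := by
  induction t using Nat.twoStepInduction with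
  | zero => simp
  | one => simp [h₁]; ring
  | more t ih₀ ih₁ =>
    set P : ℕ → ℝ := fun t => (∏ j ∈ Finset.range t, (1 + β j)) * y t with hP
    have e₀ : 1 + β t ≠ 0 := by linarith [hβ t]
    have e₁ : 1 + β (t + 1) ≠ 0 := by linarith [hβ (t + 1)]
    have hrec : P (t + 2) = 2 * (1 + β (t + 1)) * P (t + 1) - P t := by
      have h := hy (t + 1) (by omega)
      rw [Nat.add_sub_cancel] at h
      have h' : y (t + 2) = 2 * y (t + 1) - y t / ((1 + β t) * (1 + β (t + 1))) := by linarith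
      simp only [hP, Finset.prod_range_succ, h']
      field_simp
    have hS : ∑ k ∈ Finset.Ico 1 (t + 1), 2 * ((t : ℝ) - k) * (β k * P k)
        = ∑ k ∈ Finset.Ico 1 t, 2 * ((t : ℝ) - k) * (β k * P k) := by
      refine (Finset.sum_subset (Finset.Ico_subset_Ico_right (Nat.le_succ t)) ?_).symm
      intro j hj hj'
      rw [Finset.mem_Ico] at hj hj'
      rw [show j = t by omega]
      simp
    have hR : ∑ k ∈ Finset.Ico 1 (t + 1), 2 * (((t + 2 : ℕ) : ℝ) - k) * (β k * P k)
        = 2 * (∑ k ∈ Finset.Ico 1 (t + 1), 2 * (((t + 1 : ℕ) : ℝ) - k) * (β k * P k))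
          - ∑ k ∈ Finset.Ico 1 t, 2 * ((t : ℝ) - k) * (β k * P k) := by
      rw [← hS, Finset.mul_sum, ← Finset.sum_sub_distrib]
      refine Finset.sum_congr rfl fun k _ => ?_
      push_cast
      ring
    change P (t + 2) = y 0 + ((t + 2 : ℕ) : ℝ) * (β 0 * y 0)
      + ∑ k ∈ Finset.Ico 1 (t + 2), 2 * (((t + 2 : ℕ) : ℝ) - k) * (β k * P k)
    change P t = y 0 + (t : ℝ) * (β 0 * y 0)
      + ∑ k ∈ Finset.Ico 1 t, 2 * ((t : ℝ) - k) * (β k * P k) at ih₀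
    change P (t + 1) = y 0 + ((t + 1 : ℕ) : ℝ) * (β 0 * y 0)
      + ∑ k ∈ Finset.Ico 1 (t + 1), 2 * (((t + 1 : ℕ) : ℝ) - k) * (β k * P k) at ih₁
    rw [Finset.sum_Ico_succ_top (by omega), hR, hrec]
    push_cast at *
    linear_combination 2 * ih₁ - ih₀

/-- A discrete Grönwall argument: the coefficients are nonnegative and only earlier terms occur on
the right. -/
theorem le_majorant (hβ : ∀ k, 0 ≤ β k) (h₁ : y 1 = y 0)
    (hy : ∀ t, 1 ≤ t → y (t + 1) - 2 * y t + y (t - 1) / ((1 + β (t - 1)) * (1 + β t)) = 0)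
    {n : ℕ → ℝ} {N : ℕ∞} (hn₀ : n 0 = y 0)
    (hn : ∀ t : ℕ, (t : ℕ∞) ≤ N → n t ≤ n 0 + t * (β 0 * n 0)
      + ∑ k ∈ Finset.Ico 1 t, 2 * ((t : ℝ) - k) * (β k * n k))
    (t : ℕ) (ht : (t : ℕ∞) ≤ N) :
    n t ≤ (∏ j ∈ Finset.range t, (1 + β j)) * y t := by
  induction t using Nat.strong_induction_on with
  | _ t ih =>
    rw [majorant_eq hβ h₁ hy]
    refine (hn t ht).trans ?_
    rw [hn₀]
    gcongr with k hk
    · rw [Finset.mem_Ico] at hk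
      have : (k : ℝ) ≤ t := by exact_mod_cast hk.2.le
      linarith
    · exact hβ k
    · rw [Finset.mem_Ico] at hk
      exact ih k hk.2 (le_trans (by exact_mod_cast hk.2.le) ht)

end Majorant

theorem restrict_zero {V : Type*} (S : Set V) : restrict S (0 : V → ℝ) = 0 :=
  Set.indicator_zero' ..

/-- There are finitely many subsets of V. The uniform bound is what makes the rates finite even for
an infinite horizon. -/
theorem exists_l2_mulVec_restrict_le {V : Type*} [Fintype V] (M : Matrix V V ℝ) (v : V → ℝ) :
    ∃ C, ∀ S : Set V, l2 (M *ᵥ restrict S v) ≤ C := by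
  obtain ⟨C, hC⟩ := (Set.finite_range fun S : Set V => l2 (M *ᵥ restrict S v)).bddAbove
  exact ⟨C, fun S => hC ⟨S, rfl⟩⟩

theorem le_l2_of_activeNodes_nonempty {V : Type*} [Fintype V] {G : SimpleGraph V}
    [DecidableRel G.Adj] {ε : ℝ} (hε : 0 < ε) (hdeg : ∀ v, 0 < G.degree v) {r : V → ℝ}
    (h : (activeNodes G ε r).Nonempty) : ε ≤ l2 r := by
  obtain ⟨u, hu⟩ := h
  have h₁ : ε * √(G.degree u : ℝ) ≤ |r u| := (Finset.mem_filter.1 hu).2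
  have h₂ : 1 ≤ √(G.degree u : ℝ) := Real.one_le_sqrt.2 (by exact_mod_cast hdeg u)
  exact (le_mul_of_one_le_right hε.le h₂).trans (h₁.trans (abs_apply_le_l2 r u))

/-! ### Spectrum of W and invertibility of Q -/

section Spectrum

variable {V : Type*} [Fintype V] [DecidableEq V] {G : SimpleGraph V} [DecidableRel G.Adj]
  {α : ℝ} {U : Matrix V V ℝ} {lam : V → ℝ}

theorem normAdj_mulVec_apply (v : V → ℝ) (i : V) :
    (normAdj G *ᵥ v) i =
      1 / √(G.degree i : ℝ) * ∑ j ∈ G.neighborFinset i, 1 / √(G.degree j : ℝ) * v j := by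
  simp only [normAdj, invSqrtDeg, ← Matrix.mulVec_mulVec, Matrix.mulVec_diagonal,
    SimpleGraph.adjMatrix_mulVec_apply]

/-- The vector w = D^{-1/2} v solves A w = l D w; at a node where |w| is maximal, the neighbour sum
is at most the degree times that maximum. -/
theorem abs_eigenvalue_normAdj_le_one (hdeg : ∀ v, 0 < G.degree v) {v : V → ℝ} (hv : v ≠ 0)
    {l : ℝ} (h : normAdj G *ᵥ v = l • v) : |l| ≤ 1 := by
  obtain ⟨i₀, hi₀⟩ := Function.ne_iff.1 hv
  have hsq : ∀ i, 0 < √(G.degree i : ℝ) := fun i => Real.sqrt_pos.2 (by exact_mod_cast hdeg i)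
  set w : V → ℝ := fun i => 1 / √(G.degree i : ℝ) * v i with hw
  obtain ⟨i, -, hi⟩ := Finset.exists_max_image Finset.univ (fun i => |w i|) ⟨i₀, Finset.mem_univ _⟩
  have hwpos : 0 < |w i| := by
    refine lt_of_lt_of_le (abs_pos.2 ?_) (hi i₀ (Finset.mem_univ _))
    exact mul_ne_zero (one_div_pos.2 (hsq i₀)).ne' hi₀
  have key : ∑ j ∈ G.neighborFinset i, w j = l * (G.degree i * w i) := by
    have h₁ := congrFun h i
    rw [normAdj_mulVec_apply, Pi.smul_apply, smul_eq_mul] at h₁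
    have h₂ : (G.degree i : ℝ) = √(G.degree i : ℝ) * √(G.degree i : ℝ) :=
      (Real.mul_self_sqrt (Nat.cast_nonneg _)).symm
    have h₃ := (hsq i).ne'
    calc ∑ j ∈ G.neighborFinset i, w j = √(G.degree i : ℝ) * (1 / √(G.degree i : ℝ) *
          ∑ j ∈ G.neighborFinset i, w j) := by field_simp
      _ = √(G.degree i : ℝ) * (l * v i) := by rw [h₁]
      _ = l * ((√(G.degree i : ℝ) * √(G.degree i : ℝ)) * w i) := by
        simp only [hw]
        field_simp
      _ = l * (G.degree i * w i) := by rw [← h₂]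
  have hle : |∑ j ∈ G.neighborFinset i, w j| ≤ G.degree i * |w i| := by
    refine (Finset.abs_sum_le_sum_abs _ _).trans ?_
    refine (Finset.sum_le_card_nsmul _ _ _ fun j _ => hi j (Finset.mem_univ _)).trans ?_
    rw [SimpleGraph.card_neighborFinset_eq_degree, nsmul_eq_mul]
  have hd : (0 : ℝ) < G.degree i := by exact_mod_cast hdeg i
  rw [key, abs_mul, abs_mul, abs_of_pos hd] at hle
  exact le_of_mul_le_mul_right (by simpa using hle) (mul_pos hd hwpos)

theorem transpose_mul_self (hU : U ∈ Matrix.orthogonalGroup V ℝ) : Uᵀ * U = 1 :=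
  (Matrix.mem_orthogonalGroup_iff' V ℝ).1 hU

theorem transpose_mulVec_normAdj (hU : U ∈ Matrix.orthogonalGroup V ℝ)
    (hW : normAdj G = U * Matrix.diagonal lam * Uᵀ) (v : V → ℝ) (i : V) :
    (Uᵀ *ᵥ (normAdj G *ᵥ v)) i = lam i * (Uᵀ *ᵥ v) i := by
  rw [hW, Matrix.mulVec_mulVec, ← mul_assoc, ← mul_assoc, transpose_mul_self hU, one_mul,
    ← Matrix.mulVec_mulVec, Matrix.mulVec_diagonal]

theorem transpose_mulVec_sysMatrix (hU : U ∈ Matrix.orthogonalGroup V ℝ)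
    (hW : normAdj G = U * Matrix.diagonal lam * Uᵀ) (v : V → ℝ) (i : V) :
    (Uᵀ *ᵥ (sysMatrix G α *ᵥ v)) i = (1 - (1 - α) / (1 + α) * lam i) * (Uᵀ *ᵥ v) i := by
  rw [sysMatrix, Matrix.sub_mulVec, Matrix.one_mulVec, Matrix.smul_mulVec, Matrix.mulVec_sub,
    Matrix.mulVec_smul, Pi.sub_apply, Pi.smul_apply, transpose_mulVec_normAdj hU hW, smul_eq_mul]
  ring

theorem eigenvalue_mem_Icc (hdeg : ∀ v, 0 < G.degree v) (hU : U ∈ Matrix.orthogonalGroup V ℝ)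
    (hW : normAdj G = U * Matrix.diagonal lam * Uᵀ) (i : V) : lam i ∈ Set.Icc (-1 : ℝ) 1 := by
  have hUU := transpose_mul_self hU
  rw [Set.mem_Icc, ← abs_le]
  refine abs_eigenvalue_normAdj_le_one hdeg (v := U *ᵥ Pi.single i 1) (fun h => ?_) ?_
  · have h₁ := congrArg (Uᵀ *ᵥ ·) h
    simp only [Matrix.mulVec_mulVec, hUU, Matrix.one_mulVec, Matrix.mulVec_zero] at h₁
    simpa using congrFun h₁ i
  · rw [hW, Matrix.mulVec_mulVec, mul_assoc, hUU, mul_one, ← Matrix.mulVec_mulVec,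
      ← Matrix.mulVec_smul]
    congr 1
    ext j
    rw [Matrix.mulVec_diagonal]
    by_cases hj : j = i
    · simp [hj]
    · simp [hj]

theorem isUnit_det_sysMatrix (hα₀ : 0 < α) (hα₁ : α < 1) (hdeg : ∀ v, 0 < G.degree v)
    (hU : U ∈ Matrix.orthogonalGroup V ℝ)
    (hW : normAdj G = U * Matrix.diagonal lam * Uᵀ) : IsUnit (sysMatrix G α).det := by
  rw [isUnit_iff_ne_zero]
  intro h
  obtain ⟨v, hv, hQ⟩ := Matrix.exists_mulVec_eq_zero_iff.2 h
  refine hv (eq_zero_of_l2_eq_zero ?_)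
  rw [← l2_transpose_mulVec hU]
  convert l2_zero (V := V)
  ext i
  have h₁ := transpose_mulVec_sysMatrix (α := α) hU hW v i
  rw [hQ, Matrix.mulVec_zero] at h₁
  refine (mul_eq_zero.1 h₁.symm).resolve_left ?_
  have hκ : (1 - α) / (1 + α) < 1 := by rw [div_lt_one (by linarith)]; linarith
  have hκ' : 0 < (1 - α) / (1 + α) := div_pos (by linarith) (by linarith)
  have hl := (eigenvalue_mem_Icc hdeg hU hW i).2
  nlinarith

end Spectrum

/-! ### The residual recurrence and its solution -/

section Dynamics

variable {V : Type*} [Fintype V] [DecidableEq V] {G : SimpleGraph V} [DecidableRel G.Adj]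
  {α ε : ℝ} {s : V} {U : Matrix V V ℝ} {lam : V → ℝ}

theorem residual_one (hQ : IsUnit (sysMatrix G α).det) :
    residual G α ε s 1 = momentum α • (normAdj G *ᵥ residual G α ε s 0) := by
  change rhs G α s - sysMatrix G α *ᵥ (initStep G α *ᵥ rhs G α s)
    = momentum α • (normAdj G *ᵥ rhs G α s)
  rw [Matrix.mulVec_mulVec, initStep, Matrix.mul_nonsing_inv_cancel_left _ _ hQ,
    Matrix.sub_mulVec, Matrix.one_mulVec, Matrix.smul_mulVec, sub_sub_cancel]

theorem run_succ_xPrev (t : ℕ) : (run G α ε s (t + 1)).xPrev = iterate G α ε s t := by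
  cases t <;> rfl

theorem iterate_add_two (t : ℕ) :
    iterate G α ε s (t + 2) - iterate G α ε s (t + 1) =
      restrict (activeSet G α ε s (t + 1) : Set V) ((1 + momentum α ^ 2) • residual G α ε s (t + 1)
        + momentum α ^ 2 • (iterate G α ε s (t + 1) - iterate G α ε s t)) := by
  have h : iterate G α ε s (t + 2) - iterate G α ε s (t + 1)
      = increment G α ε (run G α ε s (t + 1)) := add_sub_cancel_left _ _
  rw [h, increment, run_succ_xPrev, restrict, restrict, restrict, Set.indicator_add']
  congr 1
  · exact (Set.indicator_const_smul _ (1 + momentum α ^ 2) (residual G α ε s (t + 1))).symm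
  · exact (Set.indicator_const_smul _ (momentum α ^ 2)
      (iterate G α ε s (t + 1) - iterate G α ε s t)).symm

theorem residual_succ (t : ℕ) :
    residual G α ε s (t + 1) = residual G α ε s t
      - sysMatrix G α *ᵥ (iterate G α ε s (t + 1) - iterate G α ε s t) := by
  cases t with
  | zero =>
    change rhs G α s - sysMatrix G α *ᵥ (initStep G α *ᵥ rhs G α s)
      = rhs G α s - sysMatrix G α *ᵥ (initStep G α *ᵥ rhs G α s - 0)
    rw [sub_zero]
  | succ t =>
    have h : iterate G α ε s (t + 2) - iterate G α ε s (t + 1)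
      = increment G α ε (run G α ε s (t + 1)) := add_sub_cancel_left _ _
    rw [h, sysMatrix, Matrix.sub_mulVec, Matrix.one_mulVec, Matrix.smul_mulVec, ← sub_add]
    rfl

variable (G α ε s) in
/-- The part of the full heavy-ball increment that the local method leaves out. -/
noncomputable def slack (t : ℕ) : V → ℝ :=
  restrict (activeSet G α ε s t : Set V)ᶜ ((1 + momentum α ^ 2) • residual G α ε s t
    + momentum α ^ 2 • (iterate G α ε s t - iterate G α ε s (t - 1)))

/-- The momentum term disappears because Q maps a difference of iterates to a difference of
residuals. -/
theorem residual_add_two (hα₀ : 0 < α) (t : ℕ) :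
    residual G α ε s (t + 2) = (2 * momentum α) • (normAdj G *ᵥ residual G α ε s (t + 1))
      - momentum α ^ 2 • residual G α ε s t + sysMatrix G α *ᵥ slack G α ε s (t + 1) := by
  have h₁ := residual_succ (G := G) (α := α) (ε := ε) (s := s) t
  have h₂ := residual_succ (G := G) (α := α) (ε := ε) (s := s) (t + 1)
  have h₃ : iterate G α ε s (t + 2) - iterate G α ε s (t + 1)
      = (1 + momentum α ^ 2) • residual G α ε s (t + 1)
        + momentum α ^ 2 • (iterate G α ε s (t + 1) - iterate G α ε s t)
        - slack G α ε s (t + 1) := by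
    rw [iterate_add_two, slack, Nat.add_sub_cancel, eq_sub_iff_add_eq, restrict, restrict,
      Set.indicator_self_add_compl]
  have h₄ : sysMatrix G α *ᵥ (iterate G α ε s (t + 1) - iterate G α ε s t)
      = residual G α ε s t - residual G α ε s (t + 1) := by rw [h₁, sub_sub_cancel]
  have hQ : sysMatrix G α *ᵥ residual G α ε s (t + 1) = residual G α ε s (t + 1)
      - ((1 - α) / (1 + α)) • (normAdj G *ᵥ residual G α ε s (t + 1)) := by
    rw [sysMatrix, Matrix.sub_mulVec, Matrix.one_mulVec, Matrix.smul_mulVec]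
  rw [h₂, h₃, Matrix.mulVec_sub, Matrix.mulVec_add, Matrix.mulVec_smul, Matrix.mulVec_smul, h₄,
    ← one_add_momentum_sq_mul hα₀, hQ]
  module

/-- At one node the last increment is a recursion that restarts from zero after inactivity. So r(k)
survives in the slack at t only if the node is active throughout k, …, t-1 and inactive at t. -/
theorem slack_eq (t : ℕ) (ht : 1 ≤ t) :
    slack G α ε s t = ∑ k ∈ Finset.Ico 1 (t + 1),
        ((1 + momentum α ^ 2) * (momentum α ^ 2) ^ (t - k)) •
          restrict (exitSet G α ε s k t) (residual G α ε s k)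
      + (momentum α ^ 2) ^ t • restrict (exitSet G α ε s 1 t) (iterate G α ε s 1) := by
  classical
  ext v
  have h := unroll_reset (fun t => v ∈ activeSet G α ε s t) (1 + momentum α ^ 2) (momentum α ^ 2)
    (fun t => residual G α ε s t v) (fun t => (iterate G α ε s t - iterate G α ε s (t - 1)) v)
    (fun t ht => by
      obtain ⟨t, rfl⟩ := Nat.exists_eq_add_of_le' ht
      simp only [Nat.add_sub_cancel]
      rw [iterate_add_two, restrict, Set.indicator_apply]
      rfl) t ht
  -- The initial increment is x(1) itself, as x(0) = 0; it is the source of u_{0,t}.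
  have h₀ : iterate G α ε s 1 - iterate G α ε s (1 - 1) = iterate G α ε s 1 := sub_zero _
  simp only [h₀] at h
  simp only [slack, restrict, Set.indicator_apply, Pi.add_apply, Finset.sum_apply, Pi.smul_apply,
    smul_eq_mul, h]
  by_cases hv : v ∈ activeSet G α ε s t
  · simp [exitSet, hv]
  · simp [exitSet, hv]

theorem uVec_zero_apply (t : ℕ) (ht : 1 ≤ t) (i : V) :
    (t : ℝ) * uVec G α ε s U lam 0 t i = ∑ j ∈ Finset.Ico 1 t, momentum α ^ (j - 1) *
      (hEntry (lam i) (t - j) * (Uᵀ *ᵥ (sysMatrix G α *ᵥ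
        restrict (exitSet G α ε s 1 j) (iterate G α ε s 1))) i) := by
  have ht' : (t : ℝ) ≠ 0 := by positivity
  rw [uVec, if_pos rfl, Pi.smul_apply, smul_eq_mul, ← mul_assoc, mul_one_div_cancel ht', one_mul,
    Finset.sum_apply]
  refine Finset.sum_congr rfl fun j _ => ?_
  rw [Pi.smul_apply, smul_eq_mul, mul_assoc (hMatrix lam j t), ← Matrix.mulVec_mulVec, hMatrix,
    Matrix.mulVec_diagonal, ← Matrix.mulVec_mulVec]

theorem uVec_pos_apply {k t : ℕ} (hk : 1 ≤ k) (ht : k < t) (i : V) :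
    ((t : ℝ) - k) * uVec G α ε s U lam k t i = ∑ j ∈ Finset.Ico k t, momentum α ^ (j - k) *
      (hEntry (lam i) (t - j) * (((1 + α) / (1 - α) - lam i) * (Uᵀ *ᵥ
        restrict (exitSet G α ε s k j) (residual G α ε s k)) i)) := by
  have ht' : (t : ℝ) - k ≠ 0 := by
    have : (k : ℝ) < t := by exact_mod_cast ht
    linarith
  rw [uVec, if_neg (by omega), Pi.smul_apply, smul_eq_mul, ← mul_assoc, mul_one_div_cancel ht',
    one_mul, Finset.sum_apply]
  refine Finset.sum_congr rfl fun j _ => ?_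
  rw [Pi.smul_apply, smul_eq_mul, mul_assoc (hMatrix lam j t), ← Matrix.mulVec_mulVec, hMatrix,
    Matrix.mulVec_diagonal, ← Matrix.mulVec_mulVec, Matrix.sub_mulVec, Matrix.smul_mulVec,
    Matrix.one_mulVec, Pi.sub_apply, Matrix.mulVec_diagonal, Pi.smul_apply, smul_eq_mul, sub_mul]

/-- After the sums over j and k are exchanged, (1+α̃²)Q = 2α̃((1+α)/(1-α) I - W) and α̃^{2(j-k)}
α̃^{-j} = α̃^{j-k} α̃^{-k} produce the weights of u_{k,t}. -/
theorem sum_hEntry_mul_slack (hα₀ : 0 < α) (hα₁ : α < 1) (hU : U ∈ Matrix.orthogonalGroup V ℝ)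
    (hW : normAdj G = U * Matrix.diagonal lam * Uᵀ) (t : ℕ) (ht : 1 ≤ t) (i : V) :
    ∑ j ∈ Finset.Ico 1 t, hEntry (lam i) (t - j) *
        ((momentum α ^ (j + 1))⁻¹ * (Uᵀ *ᵥ (sysMatrix G α *ᵥ slack G α ε s j)) i)
      = t * uVec G α ε s U lam 0 t i + ∑ k ∈ Finset.Ico 1 t,
        2 * (momentum α ^ k)⁻¹ * (((t : ℝ) - k) * uVec G α ε s U lam k t i) := by
  have hμ := (momentum_pos hα₁).ne'
  have hκ := one_add_momentum_sq_mul hα₀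
  rw [uVec_zero_apply t ht]
  have h₁ : ∑ k ∈ Finset.Ico 1 t,
        2 * (momentum α ^ k)⁻¹ * (((t : ℝ) - k) * uVec G α ε s U lam k t i)
      = ∑ k ∈ Finset.Ico 1 t, ∑ j ∈ Finset.Ico k t,
        2 * (momentum α ^ k)⁻¹ * (momentum α ^ (j - k) *
      (hEntry (lam i) (t - j) * (((1 + α) / (1 - α) - lam i) * (Uᵀ *ᵥ
        restrict (exitSet G α ε s k j) (residual G α ε s k)) i))) := by
    refine Finset.sum_congr rfl fun k hk => ?_
    rw [Finset.mem_Ico] at hk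
    rw [uVec_pos_apply hk.1 hk.2, Finset.mul_sum]
  rw [h₁, Finset.sum_Ico_Ico_comm, ← Finset.sum_add_distrib]
  refine Finset.sum_congr rfl fun j hj => ?_
  rw [Finset.mem_Ico] at hj
  rw [slack_eq j hj.1, Matrix.mulVec_add, Matrix.mulVec_add, Pi.add_apply, Matrix.mulVec_sum,
    Matrix.mulVec_sum, Matrix.mulVec_smul, Matrix.mulVec_smul, mul_add, mul_add, add_comm]
  congr 1
  · obtain ⟨m, rfl⟩ := Nat.exists_eq_add_of_le' hj.1
    rw [Pi.smul_apply, smul_eq_mul, Nat.add_sub_cancel]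
    field_simp
    ring
  · rw [Finset.sum_apply, Finset.mul_sum, Finset.mul_sum]
    refine Finset.sum_congr rfl fun k hk => ?_
    rw [Finset.mem_Ico] at hk
    obtain ⟨m, rfl⟩ := Nat.exists_eq_add_of_le (Nat.lt_succ_iff.1 hk.2)
    rw [Matrix.mulVec_smul, Matrix.mulVec_smul, Pi.smul_apply, smul_eq_mul,
      transpose_mulVec_sysMatrix hU hW, Nat.add_sub_cancel_left]
    have hq : 1 - (1 - α) / (1 + α) * lam i
        = (1 - α) / (1 + α) * ((1 + α) / (1 - α) - lam i) := by
      have : 1 - α ≠ 0 := by linarith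
      have : 1 + α ≠ 0 := by linarith
      field_simp
    rw [hq]
    generalize (Uᵀ *ᵥ restrict (exitSet G α ε s k (k + m)) (residual G α ε s k)) i = R
    generalize hEntry (lam i) (t - (k + m)) = H
    generalize (1 + α) / (1 - α) - lam i = X
    calc _ = H * X * R * (momentum α ^ (k + m + 1))⁻¹ * (momentum α ^ 2) ^ m *
          ((1 + momentum α ^ 2) * ((1 - α) / (1 + α))) := by ring
      _ = _ := by
        rw [hκ]
        field_simp
        ring

theorem scaled_residual_apply (hα₀ : 0 < α) (hα₁ : α < 1) (hdeg : ∀ v, 0 < G.degree v)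
    (hU : U ∈ Matrix.orthogonalGroup V ℝ)
    (hW : normAdj G = U * Matrix.diagonal lam * Uᵀ) (t : ℕ) (ht : 1 ≤ t) (i : V) :
    (momentum α ^ t)⁻¹ * (Uᵀ *ᵥ residual G α ε s t) i
      = Real.cos (t * Real.arccos (lam i)) * (Uᵀ *ᵥ residual G α ε s 0) i
        + (t * uVec G α ε s U lam 0 t i + ∑ k ∈ Finset.Ico 1 t,
          2 * (momentum α ^ k)⁻¹ * (((t : ℝ) - k) * uVec G α ε s U lam k t i)) := by
  have hμ := (momentum_pos hα₁).ne'
  rw [← sum_hEntry_mul_slack hα₀ hα₁ hU hW t ht]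
  have h := eq_of_chebyshev_recurrence (eigenvalue_mem_Icc hdeg hU hW i)
    (a := fun t => (momentum α ^ t)⁻¹ * (Uᵀ *ᵥ residual G α ε s t) i)
    -- The exponent is `j + 1` because the slack at time j enters the residual at time j+1.
    (g := fun j => (momentum α ^ (j + 1))⁻¹ * (Uᵀ *ᵥ (sysMatrix G α *ᵥ slack G α ε s j)) i)
    (by
      simp only [residual_one (isUnit_det_sysMatrix hα₀ hα₁ hdeg hU hW), Matrix.mulVec_smul,
        Pi.smul_apply, smul_eq_mul, transpose_mulVec_normAdj hU hW]
      field_simp)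
    (fun t => by
      simp only [residual_add_two hα₀, Matrix.mulVec_add, Matrix.mulVec_sub, Matrix.mulVec_smul,
        Pi.add_apply, Pi.sub_apply, Pi.smul_apply, smul_eq_mul, transpose_mulVec_normAdj hU hW]
      field_simp
      ring) t
  simpa using h

theorem l2_residual_div_le (hα₀ : 0 < α) (hα₁ : α < 1) (hdeg : ∀ v, 0 < G.degree v)
    (hU : U ∈ Matrix.orthogonalGroup V ℝ)
    (hW : normAdj G = U * Matrix.diagonal lam * Uᵀ) (t : ℕ) (ht : 1 ≤ t) :
    l2 (residual G α ε s t) / momentum α ^ t ≤ l2 (residual G α ε s 0)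
      + (t * l2 (uVec G α ε s U lam 0 t) + ∑ k ∈ Finset.Ico 1 t,
          2 * ((t : ℝ) - k) * (l2 (uVec G α ε s U lam k t) / momentum α ^ k)) := by
  have hμ := momentum_pos hα₁
  have hvec : (momentum α ^ t)⁻¹ • (Uᵀ *ᵥ residual G α ε s t)
      = (fun i => Real.cos (t * Real.arccos (lam i)) * (Uᵀ *ᵥ residual G α ε s 0) i)
        + ((t : ℝ) • uVec G α ε s U lam 0 t + ∑ k ∈ Finset.Ico 1 t,
          (2 * (momentum α ^ k)⁻¹ * ((t : ℝ) - k)) • uVec G α ε s U lam k t) := by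
    ext i
    simp only [Pi.add_apply, Pi.smul_apply, smul_eq_mul, Finset.sum_apply,
      scaled_residual_apply hα₀ hα₁ hdeg hU hW t ht, mul_assoc]
  have hl : l2 (residual G α ε s t) / momentum α ^ t
      = l2 ((momentum α ^ t)⁻¹ • (Uᵀ *ᵥ residual G α ε s t)) := by
    rw [l2_smul, l2_transpose_mulVec hU, abs_of_pos (by positivity)]
    field_simp
  rw [hl, hvec]
  refine (l2_add_le _ _).trans (add_le_add ?_ ((l2_add_le _ _).trans (add_le_add ?_ ?_)))
  · rw [← l2_transpose_mulVec hU (residual G α ε s 0)]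
    refine l2_mono fun i => ?_
    rw [abs_mul]
    exact mul_le_of_le_one_left (abs_nonneg _) (Real.abs_cos_le_one _)
  · rw [l2_smul, Nat.abs_cast]
  · refine (l2_sum_le _ _).trans (Finset.sum_le_sum fun k hk => ?_)
    rw [Finset.mem_Ico] at hk
    have : (0 : ℝ) ≤ (t : ℝ) - k := by
      rw [sub_nonneg]; exact_mod_cast hk.2.le
    rw [l2_smul, abs_of_nonneg (by positivity)]
    apply le_of_eq
    field_simp

end Dynamics

/-! ### Finiteness of the rates and the residual bound -/

section Rates

variable {V : Type*} [Fintype V] [DecidableEq V] {G : SimpleGraph V} [DecidableRel G.Adj]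
  {α ε : ℝ} {s : V} {U : Matrix V V ℝ} {lam : V → ℝ} {N : ℕ∞}

theorem l2_hMatrix_mulVec_le (hlam : ∀ i, lam i ∈ Set.Icc (-1 : ℝ) 1) (j t : ℕ) (w : V → ℝ) :
    l2 (hMatrix lam j t *ᵥ w) ≤ (t - j : ℕ) * l2 w := by
  have h := l2_smul ((t - j : ℕ) : ℝ) w
  rw [Nat.abs_cast] at h
  rw [← h]
  refine l2_mono fun i => ?_
  rw [hMatrix, Matrix.mulVec_diagonal, Pi.smul_apply, smul_eq_mul, abs_mul, abs_mul, Nat.abs_cast]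
  exact mul_le_mul_of_nonneg_right (abs_hEntry_le (hlam i) _) (abs_nonneg _)

/-- Entries of H are at most t-j ≤ m, which cancels the average, and a geometric series remains. The
divisor m is separate from t-k because u_{0,t} is divided by t although its sum starts at j = 1. -/
theorem l2_average_hMatrix_le (hα₀ : 0 < α) (hα₁ : α < 1)
    (hlam : ∀ i, lam i ∈ Set.Icc (-1 : ℝ) 1) {w : ℕ → V → ℝ} {C : ℝ} (hw : ∀ j, l2 (w j) ≤ C)
    {k t : ℕ} {m : ℝ} (hm : 0 < m) (hkt : (t : ℝ) - k ≤ m) :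
    l2 ((1 / m) • ∑ j ∈ Finset.Ico k t, momentum α ^ (j - k) • (hMatrix lam j t *ᵥ w j))
      ≤ C / (1 - momentum α) := by
  have hμ := momentum_pos hα₁
  have hμ' := one_sub_momentum_pos hα₀
  have hC : 0 ≤ C := (l2_nonneg _).trans (hw 0)
  have hterm : ∀ j ∈ Finset.Ico k t,
      l2 (momentum α ^ (j - k) • (hMatrix lam j t *ᵥ w j)) ≤ momentum α ^ (j - k) * (m * C) := by
    intro j hj
    rw [Finset.mem_Ico] at hj
    rw [l2_smul, abs_of_pos (by positivity)]
    refine mul_le_mul_of_nonneg_left ?_ (by positivity)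
    refine (l2_hMatrix_mulVec_le hlam j t _).trans ?_
    refine mul_le_mul ?_ (hw j) (l2_nonneg _) hm.le
    rw [Nat.cast_sub hj.2.le]
    have : (k : ℝ) ≤ j := by exact_mod_cast hj.1
    linarith
  have hgeom : ∑ j ∈ Finset.Ico k t, momentum α ^ (j - k) ≤ 1 / (1 - momentum α) := by
    rw [Finset.sum_Ico_eq_sum_range, le_div_iff₀ hμ', mul_comm]
    simp only [Nat.add_sub_cancel_left]
    rw [mul_neg_geom_sum]
    linarith [pow_pos hμ (t - k)]
  rw [l2_smul, abs_of_pos (by positivity)]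
  calc 1 / m * l2 (∑ j ∈ Finset.Ico k t, momentum α ^ (j - k) • (hMatrix lam j t *ᵥ w j))
      ≤ 1 / m * (1 / (1 - momentum α) * (m * C)) := by
        refine mul_le_mul_of_nonneg_left ?_ (by positivity)
        refine (l2_sum_le _ _).trans ((Finset.sum_le_sum hterm).trans ?_)
        rw [← Finset.sum_mul]
        exact mul_le_mul_of_nonneg_right hgeom (by positivity)
    _ = C / (1 - momentum α) := by field_simp

theorem exists_l2_uVec_le (hα₀ : 0 < α) (hα₁ : α < 1) (hlam : ∀ i, lam i ∈ Set.Icc (-1 : ℝ) 1)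
    (k : ℕ) : ∃ C, ∀ t, k < t → l2 (uVec G α ε s U lam k t) ≤ C := by
  rcases Nat.eq_zero_or_pos k with rfl | hk
  · obtain ⟨C, hC⟩ := exists_l2_mulVec_restrict_le (Uᵀ * sysMatrix G α) (iterate G α ε s 1)
    refine ⟨C / (1 - momentum α), fun t ht => ?_⟩
    simp only [uVec, if_true, mul_assoc]
    simp only [← Matrix.mulVec_mulVec _ (hMatrix lam _ _)]
    exact l2_average_hMatrix_le hα₀ hα₁ hlam (fun j => hC (exitSet G α ε s 1 j))
      (by exact_mod_cast ht) (by simp)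
  · obtain ⟨C, hC⟩ := exists_l2_mulVec_restrict_le
      ((((1 + α) / (1 - α)) • 1 - Matrix.diagonal lam) * Uᵀ) (residual G α ε s k)
    refine ⟨C / (1 - momentum α), fun t ht => ?_⟩
    simp only [uVec, if_neg hk.ne', mul_assoc]
    simp only [← Matrix.mulVec_mulVec _ (hMatrix lam _ _)]
    exact l2_average_hMatrix_le hα₀ hα₁ hlam (fun j => hC (exitSet G α ε s k j))
      (by rw [sub_pos]; exact_mod_cast ht) le_rfl

theorem bddAbove_rates (hα₀ : 0 < α) (hα₁ : α < 1) (hlam : ∀ i, lam i ∈ Set.Icc (-1 : ℝ) 1)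
    (k : ℕ) : BddAbove (rates G α ε s U lam N k) := by
  obtain ⟨C, hC⟩ := exists_l2_uVec_le (G := G) (ε := ε) (s := s) (U := U) hα₀ hα₁ hlam k
  refine ⟨C / l2 (residual G α ε s k), ?_⟩
  rintro _ ⟨t, ht, -, rfl⟩
  exact div_le_div_of_nonneg_right (hC t ht) (l2_nonneg _)

theorem rate_nonneg (k : ℕ) : 0 ≤ rate G α ε s U lam N k := by
  refine Real.sSup_nonneg ?_
  rintro _ ⟨t, -, -, rfl⟩
  exact div_nonneg (l2_nonneg _) (l2_nonneg _)

theorem rhs_ne_zero (hα₀ : 0 < α) (hdeg : ∀ v, 0 < G.degree v) : rhs G α s ≠ 0 := by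
  intro h
  have h₁ := congrFun h s
  have h₂ : 0 < √(G.degree s : ℝ) := Real.sqrt_pos.2 (by exact_mod_cast hdeg s)
  have h₃ : 1 + α ≠ 0 := by linarith
  simp [rhs, invSqrtDeg, hα₀.ne', h₂.ne', h₃] at h₁

/-- This makes the convention β_{k,t} = 0 for r(k) = 0 harmless. The vector u_{0,t} is built from
x(1) instead, but r(0) = b never vanishes. -/
theorem uVec_eq_zero (hα₀ : 0 < α) (hdeg : ∀ v, 0 < G.degree v) {k : ℕ}
    (h : residual G α ε s k = 0) (t : ℕ) : uVec G α ε s U lam k t = 0 := by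
  have hk : k ≠ 0 := by
    rintro rfl
    exact rhs_ne_zero hα₀ hdeg h
  simp [uVec, hk, h, restrict_zero]

theorem l2_uVec_le (hα₀ : 0 < α) (hα₁ : α < 1) (hdeg : ∀ v, 0 < G.degree v)
    (hlam : ∀ i, lam i ∈ Set.Icc (-1 : ℝ) 1) {k t : ℕ} (ht : k < t) (htN : (t : ℕ∞) ≤ N) :
    l2 (uVec G α ε s U lam k t) ≤ rate G α ε s U lam N k * l2 (residual G α ε s k) := by
  rcases (l2_nonneg (residual G α ε s k)).eq_or_lt with h | h
  · rw [uVec_eq_zero hα₀ hdeg (eq_zero_of_l2_eq_zero h.symm), ← h, l2_zero, mul_zero]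
  · rw [← div_le_iff₀ h]
    exact le_csSup (bddAbove_rates hα₀ hα₁ hlam k) ⟨t, ht, htN, rfl⟩

theorem l2_residual_le (hα₀ : 0 < α) (hα₁ : α < 1) (hdeg : ∀ v, 0 < G.degree v)
    (hU : U ∈ Matrix.orthogonalGroup V ℝ)
    (hW : normAdj G = U * Matrix.diagonal lam * Uᵀ) {β : ℕ → ℝ}
    (hβ : ∀ k, β k = rate G α ε s U lam N k) {y : ℕ → ℝ} (hy₀ : y 0 = l2 (residual G α ε s 0))
    (hy₁ : y 1 = y 0)
    (hy : ∀ t, 1 ≤ t → y (t + 1) - 2 * y t + y (t - 1) / ((1 + β (t - 1)) * (1 + β t)) = 0)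
    (t : ℕ) (ht : (t : ℕ∞) ≤ N) :
    l2 (residual G α ε s t) ≤ momentum α ^ t * (∏ j ∈ Finset.range t, (1 + β j)) * y t := by
  have hμ := momentum_pos hα₁
  have hlam := eigenvalue_mem_Icc hdeg hU hW
  have h := le_majorant (n := fun t => l2 (residual G α ε s t) / momentum α ^ t) (N := N)
    (fun k => (hβ k).symm ▸ rate_nonneg k) hy₁ hy (by simp [hy₀]) ?_ t ht
  · rw [div_le_iff₀ (by positivity)] at h
    linarith
  · intro t htN
    rcases Nat.eq_zero_or_pos t with rfl | ht
    · simp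
    refine (l2_residual_div_le (U := U) hα₀ hα₁ hdeg hU hW t ht).trans ?_
    simp only [pow_zero, div_one, ← add_assoc]
    rw [add_assoc, add_assoc]
    refine add_le_add le_rfl (add_le_add ?_ (Finset.sum_le_sum fun k hk => ?_))
    · rw [hβ]
      exact mul_le_mul_of_nonneg_left (l2_uVec_le hα₀ hα₁ hdeg hlam ht htN) (Nat.cast_nonneg _)
    · rw [Finset.mem_Ico] at hk
      have hkt : (0 : ℝ) ≤ (t : ℝ) - k := by
        rw [sub_nonneg]; exact_mod_cast hk.2.le
      rw [hβ, ← mul_div_assoc (rate G α ε s U lam N k)]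
      have := l2_uVec_le (G := G) (ε := ε) (s := s) (U := U) hα₀ hα₁ hdeg hlam hk.2 htN
      exact mul_le_mul_of_nonneg_left
        (div_le_div_of_nonneg_right this (pow_pos hμ k).le) (by positivity)

end Rates

/-! ### Runtime and exponential decay -/

section Runtime

variable {V : Type*} [Fintype V] [DecidableEq V] {G : SimpleGraph V} [DecidableRel G.Adj]
  {α ε : ℝ} {s : V}

theorem avgVol_nonneg (T : ℕ) : 0 ≤ avgVol G α ε s T := by
  refine mul_nonneg (by positivity) (Finset.sum_nonneg fun t _ => ?_)
  exact Finset.sum_nonneg fun v _ => Nat.cast_nonneg _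

theorem runtime_eq {T : ℕ} (hT : 1 ≤ T) : runtime G α ε s T = T * avgVol G α ε s T := by
  have : (T : ℝ) ≠ 0 := by positivity
  rw [avgVol, ← mul_assoc, mul_one_div_cancel this, one_mul, runtime]

theorem prod_eq_geomMean_pow {β : ℕ → ℝ} (hβ : ∀ k, 0 ≤ β k) {t : ℕ} (ht : 1 ≤ t) :
    ∏ j ∈ Finset.range t, (1 + β j) = geomMean β t ^ t := by
  rw [geomMean, one_div, Real.rpow_inv_natCast_pow _ (by omega)]
  exact Finset.prod_nonneg fun j _ => by linarith [hβ j]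

/-- The contraction factor `α̃ (1 + c√α / (1 - √α)) = 1 - (2 - c)√α / (1 + √α)` after `t` steps. -/
theorem momentum_mul_pow_le_exp (hα₀ : 0 < α) (hα₁ : α < 1) {c : ℝ} (hc₀ : 0 ≤ c) (t : ℕ) :
    (momentum α * (1 + c * √α / (1 - √α))) ^ t
      ≤ Real.exp (-(t * ((2 - c) * √α / (1 + √α)))) := by
  have h₀ := Real.sqrt_pos.2 hα₀
  have h₁ : √α < 1 := by rw [Real.sqrt_lt' one_pos]; simpa using hα₁
  have h₂ : 0 < 1 - √α := by linarith
  have hnn : 0 ≤ momentum α * (1 + c * √α / (1 - √α)) :=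
    mul_nonneg (momentum_pos hα₁).le (by positivity)
  have he : momentum α * (1 + c * √α / (1 - √α)) = -((2 - c) * √α / (1 + √α)) + 1 := by
    rw [momentum]
    field_simp
    ring
  calc _ ≤ Real.exp (-((2 - c) * √α / (1 + √α))) ^ t :=
        pow_le_pow_left₀ hnn (he.trans_le (Real.add_one_le_exp _)) t
    _ = _ := by rw [← Real.exp_nat_mul]; ring_nf

end Runtime

end LocHB

/-! ### The convergence theorem -/

theorem mainTheorem5 {V : Type*} [Fintype V] [DecidableEq V]
    (G : SimpleGraph V) [DecidableRel G.Adj] (hdeg : ∀ v, 0 < G.degree v)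
    (s : V) (α ε : ℝ) (hα₀ : 0 < α) (hα₁ : α < 1) (hε : 0 < ε)
    (U : Matrix V V ℝ) (hU : U ∈ Matrix.orthogonalGroup V ℝ) (lam : V → ℝ)
    (hW : LocHB.normAdj G = U * Matrix.diagonal lam * Uᵀ)
    (N : ℕ∞) (β : ℕ → ℝ) (hβ : ∀ k, β k = LocHB.rate G α ε s U lam N k)
    (y : ℕ → ℝ) (hy₀ : y 0 = LocHB.l2 (LocHB.residual G α ε s 0))
    (hy₁ : y 1 = LocHB.l2 (LocHB.residual G α ε s 0))
    (hy : ∀ t, 1 ≤ t →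
      y (t + 1) - 2 * y t + y (t - 1) / ((1 + β (t - 1)) * (1 + β t)) = 0) :
    (∀ k, BddAbove (LocHB.rates G α ε s U lam N k)) ∧
    (∀ t, 0 < y t) ∧
    (∀ t : ℕ, 1 ≤ t → (t : ℕ∞) ≤ N →
      LocHB.l2 (LocHB.residual G α ε s t) ≤
        LocHB.momentum α ^ t * (∏ j ∈ Finset.range t, (1 + β j)) * y t) ∧
    (∀ T : ℕ, 1 ≤ T → (T : ℕ∞) ≤ N →
      (∀ t < T, (LocHB.activeSet G α ε s t).Nonempty) →
      ∀ c : ℝ, 0 ≤ c → c < 2 →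
      (∀ t : ℕ, 1 ≤ t → t ≤ T → LocHB.geomMean β t ≤ 1 + c * √α / (1 - √α)) →
        T ≤ ⌊(1 + √α) / ((2 - c) * √α) * Real.log (y T / ε)⌋₊ + 1 ∧
        LocHB.runtime G α ε s T ≤ LocHB.avgVol G α ε s T *
          ((⌊(1 + √α) / ((2 - c) * √α) * Real.log (y T / ε)⌋₊ : ℝ) + 1) ∧
        (1 ≤ Real.log (y T / ε) →
          LocHB.runtime G α ε s T ≤
            2 * ((1 + √α) * LocHB.avgVol G α ε s T / ((2 - c) * √α) *
              Real.log (y T / ε)))) := by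
  have hβ₀ : ∀ k, 0 ≤ β k := fun k => (hβ k).symm ▸ LocHB.rate_nonneg k
  have hy₁' : y 1 = y 0 := hy₁.trans hy₀.symm
  have hy₀pos : 0 < y 0 := by
    rw [hy₀]
    refine lt_of_le_of_ne (LocHB.l2_nonneg _) fun h => ?_
    exact LocHB.rhs_ne_zero hα₀ hdeg (LocHB.eq_zero_of_l2_eq_zero h.symm)
  have hpos := LocHB.majorant_pos_mono hβ₀ hy₀pos hy₁' hy
  have hmono : Monotone y := monotone_nat_of_le_succ fun t => (hpos t).2
  have hres := LocHB.l2_residual_le hα₀ hα₁ hdeg hU hW hβ hy₀ hy₁' hy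
  refine ⟨LocHB.bddAbove_rates hα₀ hα₁ (LocHB.eigenvalue_mem_Icc hdeg hU hW),
    fun t => (hpos t).1, fun t _ ht => hres t ht, ?_⟩
  intro T hT hTN hact c hc₀ hc₂ hgeom
  have hq := Real.sqrt_pos.2 hα₀
  have hq₁ : √α < 1 := by rw [Real.sqrt_lt' one_pos]; simpa using hα₁
  have hden : 0 < (2 - c) * √α := mul_pos (by linarith) hq
  have hTle : T ≤ ⌊(1 + √α) / ((2 - c) * √α) * Real.log (y T / ε)⌋₊ + 1 := by
    -- The last time known to be active is t = T-1, which accounts for the final + 1.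
    obtain ⟨t, rfl⟩ := Nat.exists_eq_add_of_le' hT
    refine Nat.succ_le_succ ?_
    rcases Nat.eq_zero_or_pos t with rfl | ht
    · exact Nat.zero_le _
    have h₁ := LocHB.le_l2_of_activeNodes_nonempty hε hdeg (hact t (Nat.lt_succ_self t))
    have h₂ := hres t (le_trans (by exact_mod_cast Nat.le_succ t) hTN)
    have h₃ : LocHB.momentum α ^ t * (∏ j ∈ Finset.range t, (1 + β j))
        ≤ Real.exp (-(t * ((2 - c) * √α / (1 + √α)))) := by
      refine le_trans ?_ (LocHB.momentum_mul_pow_le_exp hα₀ hα₁ hc₀ t)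
      rw [LocHB.prod_eq_geomMean_pow hβ₀ ht, mul_pow]
      have hg : 0 ≤ LocHB.geomMean β t :=
        Real.rpow_nonneg (Finset.prod_nonneg fun j _ => by linarith [hβ₀ j]) _
      have := (LocHB.momentum_pos hα₁).le
      have := hgeom t ht (Nat.le_succ t)
      -- The bound at time t involves `y t`; monotonicity then replaces it by `y (t + 1)`, that is
      -- y_T.
      gcongr
    have h₄ : ε ≤ Real.exp (-(t * ((2 - c) * √α / (1 + √α)))) * y (t + 1) :=
      h₁.trans (h₂.trans (mul_le_mul h₃ (hpos t).2 (hpos t).1.le (Real.exp_pos _).le))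
    have h₅ : t * ((2 - c) * √α / (1 + √α)) ≤ Real.log (y (t + 1) / ε) := by
      rw [Real.le_log_iff_exp_le (div_pos (hpos _).1 hε), le_div_iff₀ hε]
      rw [Real.exp_neg, inv_mul_eq_div, le_div_iff₀ (Real.exp_pos _)] at h₄
      linarith
    refine Nat.le_floor ?_
    rw [← mul_div_assoc, div_le_iff₀ (by linarith)] at h₅
    rw [div_mul_eq_mul_div, le_div_iff₀ hden]
    linarith
  have hTle' : (T : ℝ) ≤ (⌊(1 + √α) / ((2 - c) * √α) * Real.log (y T / ε)⌋₊ : ℝ) + 1 := by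
    exact_mod_cast hTle
  have hA := LocHB.avgVol_nonneg (G := G) (α := α) (ε := ε) (s := s) T
  have hrun : LocHB.runtime G α ε s T ≤ LocHB.avgVol G α ε s T *
      ((⌊(1 + √α) / ((2 - c) * √α) * Real.log (y T / ε)⌋₊ : ℝ) + 1) := by
    rw [LocHB.runtime_eq hT, mul_comm]
    exact mul_le_mul_of_nonneg_left hTle' hA
  refine ⟨hTle, hrun, fun hlog => hrun.trans ?_⟩
  -- Here (2-c)√α ≤ 2√α ≤ 1+√α; once X ≥ 1, the count ⌊X⌋ + 1 is at most 2X.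
  have hX : 1 ≤ (1 + √α) / ((2 - c) * √α) * Real.log (y T / ε) := by
    refine one_le_mul_of_one_le_of_one_le ?_ hlog
    rw [one_le_div hden]
    nlinarith
  have hfl := Nat.floor_le (zero_le_one.trans hX)
  calc _ ≤ LocHB.avgVol G α ε s T * (2 * ((1 + √α) / ((2 - c) * √α) * Real.log (y T / ε))) :=
        mul_le_mul_of_nonneg_left (by linarith) hA
    _ = _ := by ring
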